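/- Let $\mathcal Z$ be a measurable space, $\rho$ a probability measure on $\mathcal Z$, and $f:\mathbb R^d\times\mathcal Z\to\mathbb R$ a loss such that $z\mapsto f(w;z)$ is measurable for every $w$ and such that, for every $z\in\mathcal Z$, the function $w\mapsto f(w;z)$ is nonnegative, convex and $L$-smooth on $\mathbb R^d$ with $L>0$ (i.e. differentiable with $\|\nabla f(w;z)-\nabla f(v;z)\|_2\le L\|w-v\|_2$ for all $w,v\in\mathbb R^d$, gradients being taken in $w$). Let $F(w)=\mathbb E_{z\sim\rho}[f(w;z)]$, let $\Omega\subseteq\mathbb R^d$ be closed and convex with Euclidean projection $\Pi_\Omega$ (for instance $\Omega=\mathbb R^d$), and let $w^*\in\arg\min_{w\in\Omega}F(w)$ with $F(w^*)<\infty$. Let $n,T\ge1$, let $S=(z_1,\dots,z_n)$ be drawn i.i.d. from $\rho$, and let $i_1,\dots,i_T$ be drawn independently (also of $S$) from the uniform distribution on $\{1,\dots,n\}$. Projected SGD with positive step sizes $\eta_1,\dots,\eta_T$ is given by $$w_1=0,\qquad w_{t+1}=\Pi_\Omega\big(w_t-\eta_t\nabla f(w_t;z_{i_t})\big),$$ and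 its weighted average iterate is $w_T^{(1)}=\big(\sum_{t=1}^T\eta_tw_t\big)/\sum_{t=1}^T\eta_t$. Assume that $\eta_1\ge\eta_2\ge\dots\ge\eta_T$ and $\eta_t\le 1/(2L)$ for all $t$. Write $\mathbb E_{S,A}$ for the expectation over $S$ and $i_1,\dots,i_T$. **Theorem.** For every $\gamma\ge1$, the random variable $F(w_T^{(1)})$ is integrable and $$\mathbb E_{S,A}\big[F(w_T^{(1)})\big]-F(w^*)\le C\bigg(\Big(\frac1\gamma+\frac{\sum_{t=1}^T\eta_t^2}{\sum_{t=1}^T\eta_t}\Big)F(w^*)+\frac{1}{\sum_{t=1}^T\eta_t}+\frac{\gamma(1+T/n)}{n}\Big(1+\sum_{t=1}^T\eta_t^2\,F(w^*)\Big)\bigg),$$ where the constant $C>0$ depends only on $L$ and on an upper bound for $\|w^*\|_2$ (and not on $d,\mathcal Z,\rho,f,\Omega,n,T,(\eta_t)$ or $\gamma$). -/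

import Mathlib

open MeasureTheory

noncomputable section

namespace ProjSGD

/-- `g` is `L`-smooth: it is differentiable and its gradient is `L`-Lipschitz on all of `ℝ^d`. -/
def LSmooth {d : ℕ} (L : ℝ) (g : EuclideanSpace ℝ (Fin d) → ℝ) : Prop :=
  Differentiable ℝ g ∧ ∀ w v : EuclideanSpace ℝ (Fin d), ‖gradient g w - gradient g v‖ ≤ L * ‖w - v‖

/-- The population risk `F(w) = 𝔼_z[f(w; z)]`, with `z` distributed according to `ρ`. -/
def risk {d : ℕ} {Z : Type*} [MeasurableSpace Z] (ρ : Measure Z)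
    (f : EuclideanSpace ℝ (Fin d) → Z → ℝ) (w : EuclideanSpace ℝ (Fin d)) : ℝ :=
  ∫ z, f w z ∂ρ

/-- The projection `Π_Ω(x)`: a point of `Ω` at minimal Euclidean distance from `x`
(it exists and is unique when `Ω` is nonempty, closed and convex). -/
def proj {d : ℕ} (Ω : Set (EuclideanSpace ℝ (Fin d))) (x : EuclideanSpace ℝ (Fin d)) :
    EuclideanSpace ℝ (Fin d) :=
  Classical.epsilon fun y => y ∈ Ω ∧ Metric.infDist x Ω = dist x y

theorem proj_spec {d : ℕ} {Ω : Set (EuclideanSpace ℝ (Fin d))} (hc : IsClosed Ω)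
    (hne : Ω.Nonempty) (x : EuclideanSpace ℝ (Fin d)) :
    proj Ω x ∈ Ω ∧ Metric.infDist x Ω = dist x (proj Ω x) :=
  Classical.epsilon_spec (p := fun y => y ∈ Ω ∧ Metric.infDist x Ω = dist x y)
    (hc.exists_infDist_eq_dist hne x)

/-- The iterates `w_1, …, w_{T+1}` of projected SGD run on the data set `S = (z_1, …, z_n)` with
step sizes `η_1, …, η_T` and drawn indices `i_1, …, i_T`:
`w_1 = 0` and `w_{t+1} = Π_Ω(w_t - η_t ∇f(w_t; z_{i_t}))`.
Positions are counted from `0`, so `iterate … 0` is `w_1`, and `η 0`, `i 0` are `η_1`, `i_1`. -/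
def iterate {d n T : ℕ} {Z : Type*} (f : EuclideanSpace ℝ (Fin d) → Z → ℝ)
    (Ω : Set (EuclideanSpace ℝ (Fin d))) (η : Fin T → ℝ) (S : Fin n → Z) (i : Fin T → Fin n) :
    Fin (T + 1) → EuclideanSpace ℝ (Fin d) :=
  Fin.induction 0 fun t w => proj Ω (w - η t • gradient (fun v => f v (S (i t))) w)

/-- The weighted average `(∑_{t=1}^T η_t w_t) / ∑_{t=1}^T η_t` of the iterates. -/
def average {d n T : ℕ} {Z : Type*} (f : EuclideanSpace ℝ (Fin d) → Z → ℝ)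
    (Ω : Set (EuclideanSpace ℝ (Fin d))) (η : Fin T → ℝ) (S : Fin n → Z) (i : Fin T → Fin n) :
    EuclideanSpace ℝ (Fin d) :=
  (∑ t, η t)⁻¹ • ∑ t, η t • iterate f Ω η S i t.castSucc

/-- The joint law of the sample `S` (`n` independent draws from `ρ`) and of the indices
`i_1, …, i_T` (independent, uniform on `{1, …, n}`, and independent of `S`). -/
def law {Z : Type*} [MeasurableSpace Z] (ρ : Measure Z) (n T : ℕ) :
    Measure ((Fin n → Z) × (Fin T → Fin n)) :=
  (Measure.pi fun _ : Fin n => ρ).prod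
    (Measure.pi fun _ : Fin T => ProbabilityTheory.uniformOn (Set.univ : Set (Fin n)))

end ProjSGD

end

noncomputable section

open RealInnerProductSpace BigOperators

/-! The argument combines optimization error and on-average stability, with loss values in place of
gradient bounds. A nonnegative `L`-smooth function satisfies `‖∇g‖² ≤ 2Lg` (`sq_norm_gradient_le`),
so every squared gradient is paid for by a loss along the trajectory.

Optimization: for a fixed sample, expanding the distance to the comparison point and averaging over
the fresh index gives a descent inequality for the empirical risk. Since the steps decrease, it can
be weighted by `η_t` before telescoping; this bounds `∑ η_t²` times the expected empirical risks of
the iterates (`sum_sq_mul_expect_le`), which is the error term left by unweighted telescoping.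

Stability: if two samples differ only at `k`, a step with `i_t ≠ k` does not expand distances, by
cocoercivity. A step with `i_t = k` has probability `1/n` and costs a factor `1 + n/T` plus an error
proportional to `η_t²` times losses. The expected growth over `T` steps is at most `(1 + 1/T)^T ≤
3`, and the accumulated error is again the weighted loss sum.

Generalization: exchanging `z_k` with an independent point preserves the joint law, so the
population risk of the average is the mean loss at `z_k` of the average trained without `z_k`.
`le_one_add_mul` compares it with the empirical loss; its parameter `γ` trades a relative loss error
against the squared stability. -/

/-! ### Smooth, convex and nonnegative functions -/

theorem LSmooth_line_hasDerivAt {d : ℕ} {L : ℝ} {g : EuclideanSpace ℝ (Fin d) → ℝ}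
    (hg : ProjSGD.LSmooth L g) (w u : EuclideanSpace ℝ (Fin d)) (s : ℝ) :
    HasDerivAt (fun s : ℝ => g (w + s • u)) ⟪gradient g (w + s • u), u⟫ s := by
  have h1 : HasFDerivAt g (fderiv ℝ g (w + s • u)) (w + s • u) := (hg.1 _).hasFDerivAt
  have h2 : HasDerivAt (fun s : ℝ => w + s • u) u s := by
    simpa using ((hasDerivAt_id s).smul_const u).const_add w
  have := h1.comp_hasDerivAt s h2
  rwa [← inner_gradient_left] at this

theorem ProjSGD.LSmooth.le_quadratic {d : ℕ} {L : ℝ} {g : EuclideanSpace ℝ (Fin d) → ℝ}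
    (hg : ProjSGD.LSmooth L g) (w u : EuclideanSpace ℝ (Fin d)) :
    g (w + u) ≤ g w + ⟪gradient g w, u⟫ + L / 2 * ‖u‖ ^ 2 := by
  -- `φ` is `g` along the segment minus its claimed quadratic upper model; the Lipschitz gradient
  -- makes `φ` decrease, and its endpoint values give the claim.
  let φ : ℝ → ℝ := fun s => g (w + s • u) - s * ⟪gradient g w, u⟫ - L / 2 * ‖u‖ ^ 2 * s ^ 2
  have hφ : ∀ s, HasDerivAt φ (⟪gradient g (w + s • u), u⟫ - ⟪gradient g w, u⟫
      - L / 2 * ‖u‖ ^ 2 * (2 * s)) s := by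
    intro s
    have h1 := LSmooth_line_hasDerivAt hg w u s
    have h2 : HasDerivAt (fun s : ℝ => s * ⟪gradient g w, u⟫) ⟪gradient g w, u⟫ s := by
      simpa using (hasDerivAt_id s).mul_const ⟪gradient g w, u⟫
    have h3 : HasDerivAt (fun s : ℝ => L / 2 * ‖u‖ ^ 2 * s ^ 2) (L / 2 * ‖u‖ ^ 2 * (2 * s)) s := by
      simpa using (hasDerivAt_pow 2 s).const_mul (L / 2 * ‖u‖ ^ 2)
    exact (h1.sub h2).sub h3
  have hanti : AntitoneOn φ (Set.Icc 0 1) := by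
    refine antitoneOn_of_deriv_nonpos (convex_Icc 0 1)
      (fun s _ => (hφ s).continuousAt.continuousWithinAt)
      (fun s _ => (hφ s).differentiableAt.differentiableWithinAt) fun s hs => ?_
    rw [interior_Icc] at hs
    rw [(hφ s).deriv, ← inner_sub_left]
    have h1 := real_inner_le_norm (gradient g (w + s • u) - gradient g w) u
    have h2 := hg.2 (w + s • u) w
    rw [add_sub_cancel_left, norm_smul, Real.norm_of_nonneg hs.1.le] at h2
    have h3 := mul_le_mul_of_nonneg_right h2 (norm_nonneg u)
    nlinarith
  have h := hanti (Set.left_mem_Icc.2 zero_le_one) (Set.right_mem_Icc.2 zero_le_one) zero_le_one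
  simp only [φ, one_smul, zero_smul, add_zero, one_mul, zero_mul, sub_zero] at h
  norm_num at h
  rw [inner_gradient_left]
  linarith

theorem ProjSGD.LSmooth.first_order_le {d : ℕ} {L : ℝ} {g : EuclideanSpace ℝ (Fin d) → ℝ}
    (hg : ProjSGD.LSmooth L g) (hc : ConvexOn ℝ Set.univ g) (w u : EuclideanSpace ℝ (Fin d)) :
    g w + ⟪gradient g w, u⟫ ≤ g (w + u) := by
  have hconv : ConvexOn ℝ Set.univ (fun s : ℝ => g (w + s • u)) := by
    refine ⟨convex_univ, fun s _ t _ a b ha hb hab => ?_⟩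
    have := hc.2 (Set.mem_univ (w + s • u)) (Set.mem_univ (w + t • u)) ha hb hab
    convert this using 2
    obtain rfl : b = 1 - a := by linarith
    simp only [smul_eq_mul]
    module
  have h := hconv.le_slope_of_hasDerivAt (Set.mem_univ 0) (Set.mem_univ 1) zero_lt_one
    (LSmooth_line_hasDerivAt hg w u 0)
  simp [slope] at h
  rw [inner_gradient_left]
  linarith

/-- A gradient step of size `1/L` lowers the quadratic upper model by `‖∇g‖²/(2L)`, yet cannot take
`g` below zero. -/
theorem ProjSGD.LSmooth.sq_norm_gradient_le {d : ℕ} {L : ℝ} (hL : 0 < L)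
    {g : EuclideanSpace ℝ (Fin d) → ℝ} (hg : ProjSGD.LSmooth L g) (h0 : ∀ w, 0 ≤ g w)
    (w : EuclideanSpace ℝ (Fin d)) : ‖gradient g w‖ ^ 2 ≤ 2 * L * g w := by
  have h := hg.le_quadratic w (-(L⁻¹ • gradient g w))
  have h1 := h0 (w + -(L⁻¹ • gradient g w))
  rw [inner_neg_right, real_inner_smul_right, real_inner_self_eq_norm_sq, norm_neg, norm_smul,
    Real.norm_of_nonneg (inv_pos.2 hL).le, mul_pow] at h
  have h2 : L / 2 * (L⁻¹ ^ 2 * ‖gradient g w‖ ^ 2) = L⁻¹ * ‖gradient g w‖ ^ 2 / 2 := by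
    field_simp
  have h3 : L⁻¹ * ‖gradient g w‖ ^ 2 ≤ 2 * g w := by linarith
  rw [inv_mul_le_iff₀ hL] at h3
  linarith

theorem ProjSGD.LSmooth.cocoercive {d : ℕ} {L : ℝ} (hL : 0 < L)
    {g : EuclideanSpace ℝ (Fin d) → ℝ} (hg : ProjSGD.LSmooth L g) (hc : ConvexOn ℝ Set.univ g)
    (w v : EuclideanSpace ℝ (Fin d)) :
    ‖gradient g w - gradient g v‖ ^ 2 ≤ L * ⟪gradient g w - gradient g v, w - v⟫ := by
  -- Sandwich `g` at `w - L⁻¹ • q` between the quadratic model at `w` and the tangent at `v`. Adding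
  -- the result to its copy with `w` and `v` exchanged gives cocoercivity.
  have key : ∀ w v : EuclideanSpace ℝ (Fin d),
      g v + ⟪gradient g v, w - v⟫ + L⁻¹ * ‖gradient g w - gradient g v‖ ^ 2 / 2 ≤ g w := by
    intro w v
    set q := gradient g w - gradient g v with hq
    have h1 := hg.le_quadratic w (-(L⁻¹ • q))
    have h2 := hg.first_order_le hc v (w - v + -(L⁻¹ • q))
    have h4 : v + (w - v + -(L⁻¹ • q)) = w + -(L⁻¹ • q) := by abel
    rw [h4, inner_add_right] at h2
    have h3 : ⟪gradient g w, -(L⁻¹ • q)⟫ - ⟪gradient g v, -(L⁻¹ • q)⟫ = -(L⁻¹ * ‖q‖ ^ 2) := by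
      rw [← inner_sub_left, ← hq, inner_neg_right, real_inner_smul_right,
        real_inner_self_eq_norm_sq]
    rw [norm_neg, norm_smul, Real.norm_of_nonneg (inv_pos.2 hL).le, mul_pow] at h1
    have h5 : L / 2 * (L⁻¹ ^ 2 * ‖q‖ ^ 2) = L⁻¹ * ‖q‖ ^ 2 / 2 := by field_simp
    linarith
  have h1 := key w v
  have h2 := key v w
  rw [norm_sub_rev] at h2
  have h3 : ⟪gradient g w, v - w⟫ = -⟪gradient g w, w - v⟫ := by
    rw [← neg_sub w v, inner_neg_right]
  rw [inner_sub_left, ← inv_mul_le_iff₀ hL]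
  linarith

theorem ProjSGD.LSmooth.norm_gradient_step_le {d : ℕ} {L η : ℝ} (hL : 0 < L) (hη : 0 ≤ η)
    (hηL : η * L ≤ 2) {g : EuclideanSpace ℝ (Fin d) → ℝ} (hg : ProjSGD.LSmooth L g)
    (hc : ConvexOn ℝ Set.univ g) (w v : EuclideanSpace ℝ (Fin d)) :
    ‖(w - η • gradient g w) - (v - η • gradient g v)‖ ^ 2 ≤ ‖w - v‖ ^ 2 := by
  have h := hg.cocoercive hL hc w v
  have e : (w - η • gradient g w) - (v - η • gradient g v)
      = (w - v) - η • (gradient g w - gradient g v) := by module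
  rw [e, norm_sub_sq_real, real_inner_smul_right, norm_smul, Real.norm_of_nonneg hη, mul_pow,
    real_inner_comm]
  have h0 : 0 ≤ ⟪gradient g w - gradient g v, w - v⟫ := by
    by_contra! hlt
    nlinarith [sq_nonneg ‖gradient g w - gradient g v‖]
  have h1 := mul_le_mul_of_nonneg_left h (sq_nonneg η)
  have h2 : η * (η * L) * ⟪gradient g w - gradient g v, w - v⟫
      ≤ η * 2 * ⟪gradient g w - gradient g v, w - v⟫ := by gcongr
  linarith

/-- Smoothness bounds the increase of a nonnegative loss by its value and the squared distance. -/
theorem ProjSGD.LSmooth.le_one_add_mul {d : ℕ} {L γ : ℝ} (hL : 0 < L) (hγ : 0 < γ)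
    {g : EuclideanSpace ℝ (Fin d) → ℝ} (hg : ProjSGD.LSmooth L g) (h0 : ∀ w, 0 ≤ g w)
    (w v : EuclideanSpace ℝ (Fin d)) :
    g w ≤ (1 + L / γ) * g v + (γ + L) / 2 * ‖w - v‖ ^ 2 := by
  have h := hg.le_quadratic v (w - v)
  rw [add_sub_cancel] at h
  have h1 := hg.sq_norm_gradient_le hL h0 v
  have h2 := real_inner_le_norm (gradient g v) (w - v)
  -- Young's inequality with weight `γ`; the gradient part is then absorbed into the loss by
  -- self-bounding.
  have h3 : ‖gradient g v‖ * ‖w - v‖ ≤ γ⁻¹ * ‖gradient g v‖ ^ 2 / 2 + γ / 2 * ‖w - v‖ ^ 2 := by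
    have : γ⁻¹ * ‖gradient g v‖ ^ 2 / 2 + γ / 2 * ‖w - v‖ ^ 2 - ‖gradient g v‖ * ‖w - v‖
        = γ⁻¹ / 2 * (‖gradient g v‖ - γ * ‖w - v‖) ^ 2 := by field_simp; ring
    have h' : 0 ≤ γ⁻¹ / 2 * (‖gradient g v‖ - γ * ‖w - v‖) ^ 2 := by positivity
    linarith
  have h4 : γ⁻¹ * ‖gradient g v‖ ^ 2 ≤ γ⁻¹ * (2 * L * g v) := by gcongr
  have h5 : (1 + L / γ) * g v = g v + γ⁻¹ * (2 * L * g v) / 2 := by field_simp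
  rw [h5]
  linarith

/-! ### Projection and one-step estimates -/

theorem inner_sub_proj_le_zero {d : ℕ} {Ω : Set (EuclideanSpace ℝ (Fin d))} (hc : IsClosed Ω)
    (hconv : Convex ℝ Ω) (x : EuclideanSpace ℝ (Fin d)) {y : EuclideanSpace ℝ (Fin d)}
    (hy : y ∈ Ω) : ⟪x - ProjSGD.proj Ω x, y - ProjSGD.proj Ω x⟫ ≤ 0 := by
  obtain ⟨h1, h2⟩ := ProjSGD.proj_spec hc ⟨y, hy⟩ x
  refine (norm_eq_iInf_iff_real_inner_le_zero hconv h1).1 ?_ y hy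
  rw [← dist_eq_norm, ← h2, Metric.infDist_eq_iInf]
  simp [dist_eq_norm]

/-- Add the variational inequalities of the two projections, each tested at the other projected
point, and apply Cauchy–Schwarz. -/
theorem norm_proj_sub_proj_le {d : ℕ} {Ω : Set (EuclideanSpace ℝ (Fin d))} (hc : IsClosed Ω)
    (hconv : Convex ℝ Ω) (hne : Ω.Nonempty) (x y : EuclideanSpace ℝ (Fin d)) :
    ‖ProjSGD.proj Ω x - ProjSGD.proj Ω y‖ ≤ ‖x - y‖ := by
  have h1 := inner_sub_proj_le_zero hc hconv x (ProjSGD.proj_spec hc hne y).1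
  have h2 := inner_sub_proj_le_zero hc hconv y (ProjSGD.proj_spec hc hne x).1
  set p := ProjSGD.proj Ω x
  set q := ProjSGD.proj Ω y
  have h3 : ‖p - q‖ ^ 2 = ⟪x - y, p - q⟫ + ⟪x - p, q - p⟫ + ⟪y - q, p - q⟫ := by
    rw [← real_inner_self_eq_norm_sq, ← neg_sub p q, inner_neg_right, ← sub_eq_add_neg,
      ← inner_sub_left, ← inner_add_left]
    congr 1
    abel
  have h4 := real_inner_le_norm (x - y) (p - q)
  have h5 : ‖p - q‖ * ‖p - q‖ ≤ ‖x - y‖ * ‖p - q‖ := by nlinarith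
  by_contra! hlt
  nlinarith [norm_nonneg (x - y)]

theorem proj_eq_self {d : ℕ} {Ω : Set (EuclideanSpace ℝ (Fin d))} (hc : IsClosed Ω)
    {x : EuclideanSpace ℝ (Fin d)} (hx : x ∈ Ω) : ProjSGD.proj Ω x = x := by
  have h := (ProjSGD.proj_spec hc ⟨x, hx⟩ x).2
  rw [Metric.infDist_zero_of_mem hx] at h
  exact (dist_eq_zero.1 h.symm).symm

theorem norm_proj_sub_le {d : ℕ} {Ω : Set (EuclideanSpace ℝ (Fin d))} (hc : IsClosed Ω)
    (hconv : Convex ℝ Ω) (x : EuclideanSpace ℝ (Fin d)) {y : EuclideanSpace ℝ (Fin d)}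
    (hy : y ∈ Ω) : ‖ProjSGD.proj Ω x - y‖ ≤ ‖x - y‖ := by
  simpa [proj_eq_self hc hy] using norm_proj_sub_proj_le hc hconv ⟨y, hy⟩ x y

theorem continuous_proj {d : ℕ} {Ω : Set (EuclideanSpace ℝ (Fin d))} (hc : IsClosed Ω)
    (hconv : Convex ℝ Ω) (hne : Ω.Nonempty) : Continuous (ProjSGD.proj Ω) :=
  (LipschitzWith.of_dist_le_mul (K := 1) fun x y => by
    simpa [dist_eq_norm] using norm_proj_sub_proj_le hc hconv hne x y).continuous

/-- Descent of the distance to a comparison point in one projected gradient step. -/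
theorem sq_norm_proj_step_sub_le {d : ℕ} {L η : ℝ} (hL : 0 < L) (hη : 0 ≤ η)
    {g : EuclideanSpace ℝ (Fin d) → ℝ} (hg : ProjSGD.LSmooth L g)
    (hcv : ConvexOn ℝ Set.univ g) (h0 : ∀ w, 0 ≤ g w)
    {Ω : Set (EuclideanSpace ℝ (Fin d))} (hc : IsClosed Ω) (hconv : Convex ℝ Ω)
    (w : EuclideanSpace ℝ (Fin d)) {y : EuclideanSpace ℝ (Fin d)} (hy : y ∈ Ω) :
    ‖ProjSGD.proj Ω (w - η • gradient g w) - y‖ ^ 2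
      ≤ ‖w - y‖ ^ 2 + 2 * η * (g y - g w) + 2 * L * η ^ 2 * g w := by
  have h1 := norm_proj_sub_le hc hconv (w - η • gradient g w) hy
  have h2 := pow_le_pow_left₀ (norm_nonneg _) h1 2
  refine h2.trans ?_
  have h3 := hg.first_order_le hcv w (y - w)
  rw [add_sub_cancel, ← neg_sub w y, inner_neg_right] at h3
  have h4 := mul_le_mul_of_nonneg_left (hg.sq_norm_gradient_le hL h0 w) (sq_nonneg η)
  have h5 := mul_le_mul_of_nonneg_left h3 hη
  have e : w - η • gradient g w - y = (w - y) - η • gradient g w := by abel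
  rw [e, norm_sub_sq_real, real_inner_smul_right, norm_smul, Real.norm_of_nonneg hη, mul_pow,
    real_inner_comm]
  linarith

/-- Two projected gradient steps along different losses. -/
theorem sq_norm_proj_step_sub_proj_step_le {d : ℕ} {L η p : ℝ} (hL : 0 < L) (hη : 0 ≤ η)
    (hp : 0 < p) {g h : EuclideanSpace ℝ (Fin d) → ℝ} (hg : ProjSGD.LSmooth L g)
    (hh : ProjSGD.LSmooth L h) (hg0 : ∀ w, 0 ≤ g w) (hh0 : ∀ w, 0 ≤ h w)
    {Ω : Set (EuclideanSpace ℝ (Fin d))} (hc : IsClosed Ω) (hconv : Convex ℝ Ω)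
    (hne : Ω.Nonempty) (w v : EuclideanSpace ℝ (Fin d)) :
    ‖ProjSGD.proj Ω (w - η • gradient g w) - ProjSGD.proj Ω (v - η • gradient h v)‖ ^ 2
      ≤ (1 + p) * ‖w - v‖ ^ 2 + (1 + 1 / p) * (4 * L * η ^ 2 * (g w + h v)) := by
  have h1 := norm_proj_sub_proj_le hc hconv hne (w - η • gradient g w) (v - η • gradient h v)
  have h2 := pow_le_pow_left₀ (norm_nonneg _) h1 2
  refine h2.trans ?_
  set a := gradient g w
  set b := gradient h v
  have e : (w - η • a) - (v - η • b) = (w - v) - η • (a - b) := by module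
  have h3 : ‖(w - η • a) - (v - η • b)‖ ≤ ‖w - v‖ + η * ‖a - b‖ := by
    rw [e]
    refine (norm_sub_le _ _).trans_eq ?_
    rw [norm_smul, Real.norm_of_nonneg hη]
  -- The two losses are unrelated, so no cancellation between gradients is available; each is
  -- bounded by its own loss.
  have h4 : ‖a - b‖ ^ 2 ≤ 4 * L * (g w + h v) := by
    have h5 := hg.sq_norm_gradient_le hL hg0 w
    have h6 := hh.sq_norm_gradient_le hL hh0 v
    have h7 := pow_le_pow_left₀ (norm_nonneg _) (norm_sub_le a b) 2
    nlinarith [sq_nonneg (‖a‖ - ‖b‖)]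
  have h8 : (‖w - v‖ + η * ‖a - b‖) ^ 2
      ≤ (1 + p) * ‖w - v‖ ^ 2 + (1 + 1 / p) * (η ^ 2 * ‖a - b‖ ^ 2) := by
    have : (1 + p) * ‖w - v‖ ^ 2 + (1 + 1 / p) * (η ^ 2 * ‖a - b‖ ^ 2)
        - (‖w - v‖ + η * ‖a - b‖) ^ 2 = 1 / p * (p * ‖w - v‖ - η * ‖a - b‖) ^ 2 := by
      field_simp
      ring
    have h' : 0 ≤ 1 / p * (p * ‖w - v‖ - η * ‖a - b‖) ^ 2 := by positivity
    linarith
  refine (pow_le_pow_left₀ (norm_nonneg _) h3 2).trans (h8.trans ?_)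
  have h9 : η ^ 2 * ‖a - b‖ ^ 2 ≤ 4 * L * η ^ 2 * (g w + h v) := by
    have := mul_le_mul_of_nonneg_left h4 (sq_nonneg η)
    linarith
  gcongr

/-! ### Averaging over a coordinate and convexity -/

/-- A random coordinate is replaced by its mean when the rest does not depend on it. -/
theorem expect_apply_eq_expect_expect {ι κ : Type*} [Fintype ι] [DecidableEq ι] [Fintype κ]
    [Nonempty κ] (t : ι) (h : κ → (ι → κ) → ℝ)
    (hh : ∀ k i k', h k (Function.update i t k') = h k i) :
    𝔼 i, h (i t) i = 𝔼 i, 𝔼 k, h k i := by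
  -- Involution exchanging coordinate `t` with an extra independent draw; it preserves the uniform
  -- average.
  let e : (ι → κ) × κ ≃ (ι → κ) × κ :=
    { toFun := fun x => (Function.update x.1 t x.2, x.1 t)
      invFun := fun x => (Function.update x.1 t x.2, x.1 t)
      left_inv := fun x => by simp
      right_inv := fun x => by simp }
  calc 𝔼 i, h (i t) i = 𝔼 i : ι → κ, 𝔼 _k : κ, h (i t) i := by simp
    _ = 𝔼 x : (ι → κ) × κ, h (x.1 t) x.1 := by
        rw [← Finset.univ_product_univ, Finset.expect_product]
    _ = 𝔼 x : (ι → κ) × κ, h x.2 x.1 :=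
        Fintype.expect_equiv e _ _ fun x => (hh _ _ _).symm
    _ = 𝔼 i, 𝔼 k, h k i := by rw [← Finset.univ_product_univ, Finset.expect_product]

theorem map_weighted_average_le {E : Type*} [AddCommGroup E] [Module ℝ E] {T : ℕ} (hT : 0 < T)
    {η : Fin T → ℝ} (hη : ∀ t, 0 < η t) {g : E → ℝ} (hg : ConvexOn ℝ Set.univ g) (x : Fin T → E) :
    g ((∑ t, η t)⁻¹ • ∑ t, η t • x t) ≤ (∑ t, η t)⁻¹ * ∑ t, η t * g (x t) := by
  have : Nonempty (Fin T) := ⟨⟨0, hT⟩⟩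
  have hs : 0 < ∑ t, η t := Finset.sum_pos (fun t _ => hη t) Finset.univ_nonempty
  exact hg.map_centerMass_le (t := Finset.univ) (fun t _ => (hη t).le) hs
    (fun t _ => Set.mem_univ (x t))

theorem convexOn_sq_norm {E : Type*} [NormedAddCommGroup E] [NormedSpace ℝ E] :
    ConvexOn ℝ Set.univ fun x : E => ‖x‖ ^ 2 :=
  convexOn_univ_norm.pow (fun _ _ => norm_nonneg _) 2

/-! ### Scalar recursions -/

section Recursions

/-- Summation by parts for decreasing weights. The induction peels off the first step, and `η 0`
becomes the bound `H` for the remaining weights. -/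
theorem sum_mul_le_of_descent {T : ℕ} {D : Fin (T + 1) → ℝ} {c η : Fin T → ℝ} {H : ℝ}
    (hD : ∀ m, 0 ≤ D m) (hη : ∀ t, 0 ≤ η t) (hanti : Antitone η) (hH : ∀ t, η t ≤ H) (hH0 : 0 ≤ H)
    (h : ∀ t, D t.succ ≤ D t.castSucc - c t) : ∑ t, η t * c t ≤ H * D 0 := by
  induction T generalizing H with
  | zero => simpa using mul_nonneg hH0 (hD 0)
  | succ T ih =>
    rw [Fin.sum_univ_succ]
    have h1 := ih (D := fun m => D m.succ) (c := fun t => c t.succ) (η := fun t => η t.succ)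
      (H := η 0) (fun m => hD _) (fun t => hη _)
      (fun s t hst => hanti (Fin.succ_le_succ_iff.2 hst)) (fun t => hanti (Fin.zero_le _))
      (hη 0) (fun t => by simpa using h t.succ)
    have h2 := mul_le_mul_of_nonneg_left (h 0) (hη 0)
    have h3 := mul_le_mul_of_nonneg_right (hH 0) (hD 0)
    simp only [Fin.castSucc_zero] at h2
    linarith

theorem last_add_sum_le_of_descent {T : ℕ} {D : Fin (T + 1) → ℝ} {c : Fin T → ℝ}
    (h : ∀ t, D t.succ ≤ D t.castSucc - c t) : D (Fin.last T) + ∑ t, c t ≤ D 0 := by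
  induction T with
  | zero => simp
  | succ T ih =>
    rw [Fin.sum_univ_succ]
    have h1 := ih (D := fun m => D m.succ) (c := fun t => c t.succ)
      (fun t => by simpa using h t.succ)
    have h2 := h 0
    simp only [Fin.castSucc_zero, Fin.succ_last] at h1 h2
    simp only [Fin.succ_zero_eq_one] at h1 h2
    linarith

/-- Discrete Grönwall bound, used with `q = 1` for pathwise control and `q = 1 + 1/T` for stability.
-/
theorem le_pow_mul_of_recursion {T : ℕ} {D : Fin (T + 1) → ℝ} {b : Fin T → ℝ} {q : ℝ}
    (hq : 1 ≤ q) (hD : ∀ m, 0 ≤ D m) (hb : ∀ t, 0 ≤ b t)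
    (h : ∀ t, D t.succ ≤ q * D t.castSucc + b t) (m : Fin (T + 1)) :
    D m ≤ q ^ T * (D 0 + ∑ t, b t) := by
  induction T with
  | zero => simp [Fin.fin_one_eq_zero m]
  | succ T ih =>
    have hs : 0 ≤ ∑ t, b t := Finset.sum_nonneg fun t _ => hb t
    cases m using Fin.cases with
    | zero =>
      have := one_le_pow₀ hq (n := T + 1)
      nlinarith [hD 0]
    | succ j =>
      have h1 := ih (D := fun m => D m.succ) (b := fun t => b t.succ) (fun m => hD _)
        (fun t => hb _) (fun t => by simpa using h t.succ) j
      have h2 := h 0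
      rw [Fin.sum_univ_succ] at hs ⊢
      simp only [Fin.castSucc_zero] at h2
      have hq0 : 0 ≤ q := by linarith
      have hs' : 0 ≤ ∑ t : Fin T, b t.succ := Finset.sum_nonneg fun t _ => hb _
      refine h1.trans ?_
      rw [pow_succ, mul_assoc]
      refine mul_le_mul_of_nonneg_left ?_ (by positivity)
      nlinarith [hb 0]

end Recursions

/-- A nonnegative, convex and `L`-smooth loss, measurable in the data point. -/
structure IsSmoothConvexLoss {d : ℕ} {Z : Type*} [MeasurableSpace Z] (L : ℝ)
    (f : EuclideanSpace ℝ (Fin d) → Z → ℝ) : Prop where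
  pos : 0 < L
  meas : ∀ w, Measurable (f w)
  nonneg : ∀ z w, 0 ≤ f w z
  convex : ∀ z, ConvexOn ℝ Set.univ (fun w => f w z)
  smooth : ∀ z, ProjSGD.LSmooth L (fun w => f w z)

/-! ### Optimization error on a fixed sample -/

section Iterates

variable {d n T : ℕ} {Z : Type*} {f : EuclideanSpace ℝ (Fin d) → Z → ℝ}
  {Ω : Set (EuclideanSpace ℝ (Fin d))} {η : Fin T → ℝ}

theorem iterate_zero (S : Fin n → Z) (i : Fin T → Fin n) : ProjSGD.iterate f Ω η S i 0 = 0 := rfl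

theorem iterate_succ (S : Fin n → Z) (i : Fin T → Fin n) (t : Fin T) :
    ProjSGD.iterate f Ω η S i t.succ = ProjSGD.proj Ω (ProjSGD.iterate f Ω η S i t.castSucc
      - η t • gradient (fun v => f v (S (i t))) (ProjSGD.iterate f Ω η S i t.castSucc)) := rfl

/-- Causality: an iterate sees only earlier indices. Hence `w_t` is independent of `i_t`, and `i_t`
can be averaged out. -/
theorem iterate_congr (S : Fin n → Z) (i j : Fin T → Fin n) (m : Fin (T + 1))
    (h : ∀ s : Fin T, s.castSucc < m → i s = j s) :
    ProjSGD.iterate f Ω η S i m = ProjSGD.iterate f Ω η S j m := by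
  induction m using Fin.induction with
  | zero => rw [iterate_zero, iterate_zero]
  | succ t ih =>
    rw [iterate_succ, iterate_succ, h t Fin.castSucc_lt_succ,
      ih fun s' hs => h s' (hs.trans Fin.castSucc_lt_succ)]

theorem iterate_update (S : Fin n → Z) (i : Fin T → Fin n) (t : Fin T) (k : Fin n) :
    ProjSGD.iterate f Ω η S (Function.update i t k) t.castSucc
      = ProjSGD.iterate f Ω η S i t.castSucc :=
  iterate_congr _ _ _ _ fun _ hs =>
    Function.update_of_ne (Fin.castSucc_lt_castSucc_iff.1 hs).ne _ _

variable [MeasurableSpace Z] {L : ℝ}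

theorem sq_norm_iterate_succ_sub_le (hf : IsSmoothConvexLoss L f) (hc : IsClosed Ω)
    (hconv : Convex ℝ Ω) (hη : ∀ t, 0 < η t)
    {y : EuclideanSpace ℝ (Fin d)} (hy : y ∈ Ω) (S : Fin n → Z) (i : Fin T → Fin n) (t : Fin T) :
    ‖ProjSGD.iterate f Ω η S i t.succ - y‖ ^ 2
      ≤ ‖ProjSGD.iterate f Ω η S i t.castSucc - y‖ ^ 2
        + 2 * η t * (f y (S (i t)) - f (ProjSGD.iterate f Ω η S i t.castSucc) (S (i t)))
        + 2 * L * η t ^ 2 * f (ProjSGD.iterate f Ω η S i t.castSucc) (S (i t)) := by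
  rw [iterate_succ]
  exact sq_norm_proj_step_sub_le hf.pos (hη t).le (hf.smooth _) (hf.convex _)
    (hf.nonneg _) hc hconv _ hy

/-- Pathwise control of the iterates. -/
theorem sq_norm_iterate_sub_le (hf : IsSmoothConvexLoss L f) (hc : IsClosed Ω)
    (hconv : Convex ℝ Ω) (hη : ∀ t, 0 < η t) (hηL : ∀ t, η t ≤ 1 / (2 * L))
    {y : EuclideanSpace ℝ (Fin d)} (hy : y ∈ Ω) (S : Fin n → Z) (i : Fin T → Fin n)
    (m : Fin (T + 1)) :
    ‖ProjSGD.iterate f Ω η S i m - y‖ ^ 2 ≤ ‖y‖ ^ 2 + ∑ t, 2 * η t * f y (S (i t)) := by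
  have h := le_pow_mul_of_recursion (q := 1)
    (D := fun m => ‖ProjSGD.iterate f Ω η S i m - y‖ ^ 2) (b := fun t => 2 * η t * f y (S (i t)))
    le_rfl (fun _ => by positivity)
    (fun t => mul_nonneg (by linarith [hη t]) (hf.nonneg _ _)) (fun t => ?_) m
  · simpa [iterate_zero] using h
  · have h1 := sq_norm_iterate_succ_sub_le hf hc hconv hη hy S i t
    have h2 := hf.nonneg (S (i t)) (ProjSGD.iterate f Ω η S i t.castSucc)
    have h3 := hηL t
    have hL := hf.pos
    rw [le_div_iff₀ (by positivity)] at h3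
    -- The step-size bound lets the loss at the iterate be dropped, leaving only losses at `y`.
    have h4 : 0 ≤ η t * (1 - L * η t) * f (ProjSGD.iterate f Ω η S i t.castSucc) (S (i t)) :=
      mul_nonneg (mul_nonneg (hη t).le (by linarith)) h2
    linarith

theorem expect_sq_norm_iterate_succ_sub_le (hn : 0 < n) (hf : IsSmoothConvexLoss L f)
    (hc : IsClosed Ω) (hconv : Convex ℝ Ω) (hη : ∀ t, 0 < η t)
    {y : EuclideanSpace ℝ (Fin d)} (hy : y ∈ Ω) (S : Fin n → Z) (t : Fin T) :
    𝔼 i, ‖ProjSGD.iterate f Ω η S i t.succ - y‖ ^ 2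
      ≤ 𝔼 i, ‖ProjSGD.iterate f Ω η S i t.castSucc - y‖ ^ 2
        + 2 * η t * (𝔼 k, f y (S k)
          - 𝔼 i, 𝔼 k, f (ProjSGD.iterate f Ω η S i t.castSucc) (S k))
        + 2 * L * η t ^ 2 * 𝔼 i, 𝔼 k, f (ProjSGD.iterate f Ω η S i t.castSucc) (S k) := by
  have : Nonempty (Fin n) := ⟨⟨0, hn⟩⟩
  have e1 : 𝔼 i : Fin T → Fin n, f y (S (i t)) = 𝔼 k, f y (S k) := by
    rw [expect_apply_eq_expect_expect t (fun k _ => f y (S k)) (fun _ _ _ => rfl),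
      Fintype.expect_const]
  have e2 := expect_apply_eq_expect_expect t
    (fun k i => f (ProjSGD.iterate f Ω η S i t.castSucc) (S k))
    (fun k i k' => by rw [iterate_update])
  have h := Finset.expect_le_expect (s := Finset.univ)
    (fun i _ => sq_norm_iterate_succ_sub_le hf hc hconv hη hy S i t)
  rwa [Finset.expect_add_distrib, Finset.expect_add_distrib, ← Finset.mul_expect,
    ← Finset.mul_expect, Finset.expect_sub_distrib, e1, e2] at h

/-- Since `2Lη_t² ≤ η_t`, half of the descent absorbs the gradient error; the other half is weighted
by `η_t` and telescoped. -/
theorem sum_sq_mul_expect_le (hn : 0 < n) (hf : IsSmoothConvexLoss L f)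
    (hc : IsClosed Ω) (hconv : Convex ℝ Ω) (hη : ∀ t, 0 < η t) (hanti : Antitone η)
    (hηL : ∀ t, η t ≤ 1 / (2 * L)) {y : EuclideanSpace ℝ (Fin d)} (hy : y ∈ Ω) (S : Fin n → Z) :
    ∑ t, η t ^ 2 * 𝔼 i, 𝔼 k, f (ProjSGD.iterate f Ω η S i t.castSucc) (S k)
      ≤ ‖y‖ ^ 2 / (2 * L) + 2 * (∑ t, η t ^ 2) * 𝔼 k, f y (S k) := by
  have : Nonempty (Fin n) := ⟨⟨0, hn⟩⟩
  have hL := hf.pos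
  set G : Fin T → ℝ := fun t => 𝔼 i, 𝔼 k, f (ProjSGD.iterate f Ω η S i t.castSucc) (S k) with hG
  have h := sum_mul_le_of_descent (H := 1 / (2 * L))
    (D := fun m => 𝔼 i, ‖ProjSGD.iterate f Ω η S i m - y‖ ^ 2)
    (c := fun t => η t * G t - 2 * η t * 𝔼 k, f y (S k))
    (fun m => Finset.expect_nonneg fun i _ => by positivity) (fun t => (hη t).le) hanti hηL
    (by positivity) (fun t => ?_)
  · simp only [iterate_zero, zero_sub, norm_neg, Fintype.expect_const] at h
    have e : ∑ t, η t * (η t * G t - 2 * η t * 𝔼 k, f y (S k))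
        = ∑ t, η t ^ 2 * G t - 2 * (∑ t, η t ^ 2) * 𝔼 k, f y (S k) := by
      rw [Finset.mul_sum, Finset.sum_mul, ← Finset.sum_sub_distrib]
      exact Finset.sum_congr rfl fun t _ => by ring
    rw [e, one_div_mul_eq_div] at h
    linarith
  · have h1 := expect_sq_norm_iterate_succ_sub_le hn hf hc hconv hη hy S t
    have h2 : 0 ≤ G t := Finset.expect_nonneg fun i _ =>
      Finset.expect_nonneg fun k _ => hf.nonneg _ _
    have h3 := hηL t
    rw [le_div_iff₀ (by positivity)] at h3
    have h4 : 0 ≤ η t * (1 - 2 * L * η t) * G t :=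
      mul_nonneg (mul_nonneg (hη t).le (by linarith)) h2
    change _ ≤ _ + 2 * η t * (_ - G t) + 2 * L * η t ^ 2 * G t at h1
    linarith

/-- Optimization error of the averaged iterate, on a fixed sample. -/
theorem expect_empirical_average_le (hn : 0 < n) (hT : 0 < T) (hf : IsSmoothConvexLoss L f)
    (hc : IsClosed Ω) (hconv : Convex ℝ Ω) (hη : ∀ t, 0 < η t) (hanti : Antitone η)
    (hηL : ∀ t, η t ≤ 1 / (2 * L)) {y : EuclideanSpace ℝ (Fin d)} (hy : y ∈ Ω) (S : Fin n → Z) :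
    𝔼 i, 𝔼 k, f (ProjSGD.average f Ω η S i) (S k)
      ≤ 𝔼 k, f y (S k)
        + (∑ t, η t)⁻¹ * (‖y‖ ^ 2 + 2 * L * (∑ t, η t ^ 2) * 𝔼 k, f y (S k)) := by
  have : Nonempty (Fin n) := ⟨⟨0, hn⟩⟩
  have : Nonempty (Fin T) := ⟨⟨0, hT⟩⟩
  have hL := hf.pos
  have hs : 0 < ∑ t, η t := Finset.sum_pos (fun t _ => hη t) Finset.univ_nonempty
  have h1 := sum_sq_mul_expect_le hn hf hc hconv hη hanti hηL hy S
  set G : Fin T → ℝ := fun t => 𝔼 i, 𝔼 k, f (ProjSGD.iterate f Ω η S i t.castSucc) (S k) with hG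
  set F := 𝔼 k, f y (S k)
  have h2 : 𝔼 i, 𝔼 k, f (ProjSGD.average f Ω η S i) (S k) ≤ (∑ t, η t)⁻¹ * ∑ t, η t * G t := by
    have h3 : ∀ (i : Fin T → Fin n) (k : Fin n), f (ProjSGD.average f Ω η S i) (S k)
        ≤ (∑ t, η t)⁻¹ * ∑ t, η t * f (ProjSGD.iterate f Ω η S i t.castSucc) (S k) :=
      fun i k => map_weighted_average_le hT hη (hf.convex (S k)) _
    refine (Finset.expect_le_expect fun i _ => Finset.expect_le_expect fun k _ => h3 i k).trans_eq
      ?_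
    simp only [← Finset.mul_expect, Finset.expect_sum_comm, hG]
  -- Now telescope without weights, keeping the full descent; the `η_t²` error is controlled by the
  -- weighted sum.
  have h4 := last_add_sum_le_of_descent
    (D := fun m => 𝔼 i, ‖ProjSGD.iterate f Ω η S i m - y‖ ^ 2)
    (c := fun t => 2 * (η t * G t) - 2 * η t * F - 2 * L * (η t ^ 2 * G t)) (fun t => by
      have := expect_sq_norm_iterate_succ_sub_le hn hf hc hconv hη hy S t
      change _ ≤ _ + 2 * η t * (_ - G t) + 2 * L * η t ^ 2 * G t at this
      linarith)
  have h5 : 0 ≤ 𝔼 i, ‖ProjSGD.iterate f Ω η S i (Fin.last T) - y‖ ^ 2 :=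
    Finset.expect_nonneg fun i _ => by positivity
  simp only [iterate_zero, zero_sub, norm_neg, Fintype.expect_const] at h4
  rw [Finset.sum_sub_distrib, Finset.sum_sub_distrib, ← Finset.mul_sum, ← Finset.mul_sum,
    ← Finset.sum_mul, ← Finset.mul_sum] at h4
  have h6 : 2 * L * ∑ t, η t ^ 2 * G t ≤ ‖y‖ ^ 2 + 4 * L * (∑ t, η t ^ 2) * F := by
    refine (mul_le_mul_of_nonneg_left h1 (by positivity)).trans_eq ?_
    field_simp
    ring
  have h7 : ∑ t, η t * G t ≤ (∑ t, η t) * F + (‖y‖ ^ 2 + 2 * L * (∑ t, η t ^ 2) * F) := by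
    linarith
  refine h2.trans ((mul_le_mul_of_nonneg_left h7 (inv_pos.2 hs).le).trans_eq ?_)
  field_simp

/-! ### Stability under replacement of one data point -/

theorem sq_norm_iterate_succ_sub_iterate_succ_le (hf : IsSmoothConvexLoss L f)
    (hc : IsClosed Ω) (hconv : Convex ℝ Ω) (hne : Ω.Nonempty) (hη : ∀ t, 0 < η t)
    (hηL : ∀ t, η t ≤ 1 / (2 * L)) {p : ℝ} (hp : 0 < p) {S S' : Fin n → Z} {k : Fin n}
    (hS : ∀ l, l ≠ k → S l = S' l) (i : Fin T → Fin n) (t : Fin T) :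
    ‖ProjSGD.iterate f Ω η S i t.succ - ProjSGD.iterate f Ω η S' i t.succ‖ ^ 2
      ≤ ‖ProjSGD.iterate f Ω η S i t.castSucc - ProjSGD.iterate f Ω η S' i t.castSucc‖ ^ 2
        + if i t = k then
          p * ‖ProjSGD.iterate f Ω η S i t.castSucc - ProjSGD.iterate f Ω η S' i t.castSucc‖ ^ 2
          + (1 + 1 / p) * (4 * L * η t ^ 2 * (f (ProjSGD.iterate f Ω η S i t.castSucc) (S k)
            + f (ProjSGD.iterate f Ω η S' i t.castSucc) (S' k))) else 0 := by
  rw [iterate_succ, iterate_succ]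
  have hL := hf.pos
  split_ifs with h
  · rw [h]
    refine (sq_norm_proj_step_sub_proj_step_le hL (hη t).le hp (hf.smooth (S k))
      (hf.smooth (S' k)) (hf.nonneg _) (hf.nonneg _) hc hconv hne _ _).trans_eq (by ring)
  · rw [hS _ h, add_zero]
    refine (pow_le_pow_left₀ (norm_nonneg _)
      (norm_proj_sub_proj_le hc hconv hne _ _) 2).trans ?_
    refine (hf.smooth (S' (i t))).norm_gradient_step_le hL (hη t).le ?_ (hf.convex _) _ _
    have h3 := hηL t
    rw [le_div_iff₀ (by positivity)] at h3
    linarith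

theorem expect_ite_apply_eq {ι κ : Type*} [Fintype ι] [DecidableEq ι] [Fintype κ] [DecidableEq κ]
    [Nonempty κ] (t : ι) (k : κ) (X : (ι → κ) → ℝ)
    (hX : ∀ i k', X (Function.update i t k') = X i) :
    𝔼 i, (if i t = k then X i else 0) = (𝔼 i, X i) / Fintype.card κ := by
  rw [expect_apply_eq_expect_expect t (fun l i => if l = k then X i else 0)
    (fun l i k' => by rw [hX]), Finset.expect_div]
  refine Finset.expect_congr rfl fun i _ => ?_
  rw [Fintype.expect_eq_sum_div_card]
  simp

/-- Stability of the iterates when one data point is replaced. -/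
theorem expect_sq_norm_iterate_sub_iterate_le (hn : 0 < n) (hf : IsSmoothConvexLoss L f)
    (hc : IsClosed Ω) (hconv : Convex ℝ Ω) (hne : Ω.Nonempty) (hη : ∀ t, 0 < η t)
    (hηL : ∀ t, η t ≤ 1 / (2 * L)) (hT : 0 < T) {S S' : Fin n → Z} {k : Fin n}
    (hS : ∀ l, l ≠ k → S l = S' l) (m : Fin (T + 1)) :
    𝔼 i, ‖ProjSGD.iterate f Ω η S i m - ProjSGD.iterate f Ω η S' i m‖ ^ 2
      ≤ 12 * L * (1 + (T : ℝ) / n) / n * ∑ t, η t ^ 2 *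
        𝔼 i, (f (ProjSGD.iterate f Ω η S i t.castSucc) (S k)
            + f (ProjSGD.iterate f Ω η S' i t.castSucc) (S' k)) := by
  have : Nonempty (Fin n) := ⟨⟨0, hn⟩⟩
  have hL := hf.pos
  have hn' : (0 : ℝ) < n := by exact_mod_cast hn
  have hT' : (0 : ℝ) < T := by exact_mod_cast hT
  set A : Fin T → ℝ := fun t => 𝔼 i, (f (ProjSGD.iterate f Ω η S i t.castSucc) (S k)
            + f (ProjSGD.iterate f Ω η S' i t.castSucc) (S' k)) with hA
  have hA0 : ∀ t, 0 ≤ A t := fun t => Finset.expect_nonneg fun i _ =>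
    add_nonneg (hf.nonneg _ _) (hf.nonneg _ _)
  set D : Fin (T + 1) → ℝ := fun m =>
    𝔼 i, ‖ProjSGD.iterate f Ω η S i m - ProjSGD.iterate f Ω η S' i m‖ ^ 2 with hD
  -- Taking `p = n/T`, the probability `1/n` of drawing `k` turns the expansion into `1 + 1/T`.
  have hstep : ∀ t : Fin T, D t.succ
      ≤ (1 + 1 / T) * D t.castSucc + 4 * L * (1 + (T : ℝ) / n) / n * (η t ^ 2 * A t) := by
    intro t
    have h := Finset.expect_le_expect (s := Finset.univ) (fun i _ =>
      sq_norm_iterate_succ_sub_iterate_succ_le hf hc hconv hne hη hηL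
        (div_pos hn' hT') hS i t)
    rw [Finset.expect_add_distrib, expect_ite_apply_eq _ _ _
      (fun i k' => by rw [iterate_update, iterate_update]), Finset.expect_add_distrib,
      ← Finset.mul_expect, ← Finset.mul_expect, ← Finset.mul_expect, Fintype.card_fin] at h
    change D t.succ ≤ D t.castSucc + ((n / T : ℝ) * D t.castSucc
      + (1 + 1 / (n / T : ℝ)) * (4 * L * η t ^ 2 * A t)) / n at h
    refine h.trans_eq ?_
    field_simp
    ring
  have h := le_pow_mul_of_recursion (D := D) (q := 1 + 1 / (T : ℝ))
    (b := fun t => 4 * L * (1 + (T : ℝ) / n) / n * (η t ^ 2 * A t)) (by simp) (fun m => Finset.expect_nonneg fun i _ => by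
    positivity) (fun t => mul_nonneg (by positivity) (mul_nonneg (sq_nonneg (η t)) (hA0 t))) hstep m
  have h0 : D 0 = 0 := by simp [hD, iterate_zero]
  rw [h0, zero_add, ← Finset.mul_sum] at h
  -- The `T`-step growth is at most `e < 3`, which turns the one-step constant `4` into `12`.
  have h3 : (1 + 1 / (T : ℝ)) ^ T ≤ 3 := by
    have h4 : (1 + 1 / (T : ℝ)) ^ T ≤ Real.exp (1 / T) ^ T := by
      refine pow_le_pow_left₀ (by positivity) ?_ T
      linarith [Real.add_one_le_exp (1 / (T : ℝ))]
    rw [← Real.exp_nat_mul, mul_one_div_cancel hT'.ne'] at h4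
    linarith [Real.exp_one_lt_d9]
  have hs : 0 ≤ ∑ t, η t ^ 2 * A t :=
    Finset.sum_nonneg fun t _ => mul_nonneg (sq_nonneg _) (hA0 t)
  refine h.trans ((mul_le_mul_of_nonneg_right h3 (by positivity)).trans_eq ?_)
  ring

/-- Stability of the averaged iterate when one data point is replaced. -/
theorem expect_sq_norm_average_sub_average_le (hn : 0 < n) (hf : IsSmoothConvexLoss L f)
    (hc : IsClosed Ω) (hconv : Convex ℝ Ω) (hne : Ω.Nonempty) (hη : ∀ t, 0 < η t)
    (hηL : ∀ t, η t ≤ 1 / (2 * L)) (hT : 0 < T) {S S' : Fin n → Z} {k : Fin n}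
    (hS : ∀ l, l ≠ k → S l = S' l) :
    𝔼 i, ‖ProjSGD.average f Ω η S i - ProjSGD.average f Ω η S' i‖ ^ 2
      ≤ 12 * L * (1 + (T : ℝ) / n) / n * ∑ t, η t ^ 2 *
        𝔼 i, (f (ProjSGD.iterate f Ω η S i t.castSucc) (S k)
            + f (ProjSGD.iterate f Ω η S' i t.castSucc) (S' k)) := by
  have : Nonempty (Fin T) := ⟨⟨0, hT⟩⟩
  have hs : 0 < ∑ t, η t := Finset.sum_pos (fun t _ => hη t) Finset.univ_nonempty
  have h1 : ∀ i : Fin T → Fin n,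
      ‖ProjSGD.average f Ω η S i - ProjSGD.average f Ω η S' i‖ ^ 2
      ≤ (∑ t, η t)⁻¹ * ∑ t, η t * ‖ProjSGD.iterate f Ω η S i t.castSucc
        - ProjSGD.iterate f Ω η S' i t.castSucc‖ ^ 2 := by
    intro i
    rw [ProjSGD.average, ProjSGD.average, ← smul_sub, ← Finset.sum_sub_distrib]
    simp only [← smul_sub]
    exact map_weighted_average_le hT hη convexOn_sq_norm _
  refine (Finset.expect_le_expect fun i _ => h1 i).trans ?_
  simp only [← Finset.mul_expect, Finset.expect_sum_comm]
  rw [inv_mul_le_iff₀ hs, Finset.sum_mul]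
  exact Finset.sum_le_sum fun t _ => mul_le_mul_of_nonneg_left
    (expect_sq_norm_iterate_sub_iterate_le hn hf hc hconv hne hη hηL hT hS _) (hη t).le

end Iterates

/-! ### Measurability and pathwise bounds -/

section Measurability

variable {d n T : ℕ} {Z : Type*} [MeasurableSpace Z] {f : EuclideanSpace ℝ (Fin d) → Z → ℝ}
  {Ω : Set (EuclideanSpace ℝ (Fin d))} {η : Fin T → ℝ} {L : ℝ}

theorem IsSmoothConvexLoss.measurable_uncurry (hf : IsSmoothConvexLoss L f) :
    Measurable fun p : EuclideanSpace ℝ (Fin d) × Z => f p.1 p.2 :=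
  measurable_uncurry_of_continuous_of_measurable
    (fun z => (hf.smooth z).1.continuous) hf.meas

/-- Each directional derivative is a limit of difference quotients measurable in `z`; the
coordinates of the gradient are such derivatives. -/
theorem IsSmoothConvexLoss.measurable_gradient (hf : IsSmoothConvexLoss L f)
    (w : EuclideanSpace ℝ (Fin d)) : Measurable fun z => gradient (fun v => f v z) w := by
  suffices h : ∀ u, Measurable fun z => fderiv ℝ (fun v => f v z) w u by
    have h2 : Measurable fun z => WithLp.ofLp (gradient (fun v => f v z) w) := by
      refine measurable_pi_iff.2 fun j => ?_
      convert h (EuclideanSpace.single j 1) using 2 with z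
      rw [← inner_gradient_left, EuclideanSpace.inner_single_right]
      simp
    exact (WithLp.measurable_toLp 2 (Fin d → ℝ)).comp h2
  intro u
  refine measurable_of_tendsto_metrizable
    (f := fun (m : ℕ) z => (m : ℝ) • (f (w + (m : ℝ)⁻¹ • u) z - f w z))
    (fun m => ((hf.meas _).sub (hf.meas _)).fun_const_smul _) (tendsto_pi_nhds.2 fun z => ?_)
  refine HasFDerivAt.lim ((hf.smooth z).1 w).hasFDerivAt u ?_
  simpa using tendsto_natCast_atTop_atTop

theorem IsSmoothConvexLoss.measurable_gradient_uncurry (hf : IsSmoothConvexLoss L f) :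
    Measurable fun p : EuclideanSpace ℝ (Fin d) × Z => gradient (fun v => f v p.2) p.1 := by
  refine measurable_uncurry_of_continuous_of_measurable
    (u := fun w z => gradient (fun v => f v z) w) (fun z => ?_) hf.measurable_gradient
  refine (LipschitzWith.of_dist_le_mul (K := ⟨L, hf.pos.le⟩) fun x y => ?_).continuous
  rw [dist_eq_norm, dist_eq_norm]
  exact (hf.smooth z).2 x y

theorem measurable_iterate (hf : IsSmoothConvexLoss L f) (hc : IsClosed Ω) (hconv : Convex ℝ Ω)
    (hne : Ω.Nonempty) (i : Fin T → Fin n) (m : Fin (T + 1)) :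
    Measurable fun S => ProjSGD.iterate f Ω η S i m := by
  induction m using Fin.induction with
  | zero => simp only [iterate_zero, measurable_const]
  | succ t ih =>
    simp only [iterate_succ]
    exact (continuous_proj hc hconv hne).measurable.comp (ih.sub
      ((hf.measurable_gradient_uncurry.comp (ih.prodMk (measurable_pi_apply (i t)))).fun_const_smul _))

theorem measurable_average (hf : IsSmoothConvexLoss L f) (hc : IsClosed Ω) (hconv : Convex ℝ Ω)
    (hne : Ω.Nonempty) (i : Fin T → Fin n) :
    Measurable fun S => ProjSGD.average f Ω η S i :=
  (Finset.measurable_sum _ fun t _ =>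
    (measurable_iterate hf hc hconv hne i t.castSucc).fun_const_smul (η t)).fun_const_smul _

theorem IsSmoothConvexLoss.measurable_risk (hf : IsSmoothConvexLoss L f) (ρ : Measure Z)
    [SFinite ρ] : Measurable (ProjSGD.risk ρ f) :=
  (hf.measurable_uncurry.stronglyMeasurable.integral_prod_right (ν := ρ)).measurable

theorem sq_norm_average_sub_le (hf : IsSmoothConvexLoss L f) (hc : IsClosed Ω)
    (hconv : Convex ℝ Ω) (hη : ∀ t, 0 < η t) (hηL : ∀ t, η t ≤ 1 / (2 * L)) (hT : 0 < T)
    {y : EuclideanSpace ℝ (Fin d)} (hy : y ∈ Ω) (S : Fin n → Z) (i : Fin T → Fin n) :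
    ‖ProjSGD.average f Ω η S i - y‖ ^ 2 ≤ ‖y‖ ^ 2 + ∑ t, 2 * η t * f y (S (i t)) := by
  have : Nonempty (Fin T) := ⟨⟨0, hT⟩⟩
  have hs : 0 < ∑ t, η t := Finset.sum_pos (fun t _ => hη t) Finset.univ_nonempty
  have e : ProjSGD.average f Ω η S i - y
      = (∑ t, η t)⁻¹ • ∑ t, η t • (ProjSGD.iterate f Ω η S i t.castSucc - y) := by
    simp only [smul_sub, Finset.sum_sub_distrib, ← Finset.sum_smul, inv_smul_smul₀ hs.ne']
    rfl
  rw [e]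
  refine (map_weighted_average_le hT hη convexOn_sq_norm _).trans ?_
  rw [inv_mul_le_iff₀ hs, Finset.sum_mul]
  exact Finset.sum_le_sum fun t _ => mul_le_mul_of_nonneg_left
    (sq_norm_iterate_sub_le hf hc hconv hη hηL hy S i _) (hη t).le

end Measurability

/-! ### Finite averages and the joint law -/

section Expect

theorem integrable_expect {X ι : Type*} [MeasurableSpace X] {μ : Measure X} [Fintype ι]
    {g : ι → X → ℝ} (hg : ∀ i, Integrable (g i) μ) : Integrable (fun x => 𝔼 i, g i x) μ := by
  simp only [Fintype.expect_eq_sum_div_card]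
  exact (integrable_finsetSum _ fun i _ => hg i).div_const _

theorem integral_expect {X ι : Type*} [MeasurableSpace X] {μ : Measure X} [Fintype ι]
    {g : ι → X → ℝ} (hg : ∀ i, Integrable (g i) μ) :
    ∫ x, 𝔼 i, g i x ∂μ = 𝔼 i, ∫ x, g i x ∂μ := by
  simp only [Fintype.expect_eq_sum_div_card]
  rw [integral_div, integral_finsetSum _ fun i _ => hg i]

end Expect

section Law

variable {Z : Type*} [MeasurableSpace Z] (ρ : Measure Z) [IsProbabilityMeasure ρ] {n T : ℕ}

theorem integrable_law (hn : 0 < n) {g : (Fin n → Z) × (Fin T → Fin n) → ℝ}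
    (hm : ∀ i, Measurable fun S => g (S, i))
    (hg : ∀ i, Integrable (fun S => g (S, i)) (Measure.pi fun _ : Fin n => ρ)) :
    Integrable g (ProjSGD.law ρ n T) := by
  have : Nonempty (Fin n) := ⟨⟨0, hn⟩⟩
  rw [ProjSGD.law, integrable_prod_iff']
  · exact ⟨Filter.Eventually.of_forall hg, Integrable.of_finite⟩
  · exact (measurable_from_prod_countable_left hm).aestronglyMeasurable

theorem integral_law (hn : 0 < n) {g : (Fin n → Z) × (Fin T → Fin n) → ℝ}
    (hm : ∀ i, Measurable fun S => g (S, i))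
    (hg : ∀ i, Integrable (fun S => g (S, i)) (Measure.pi fun _ : Fin n => ρ)) :
    ∫ x, g x ∂ProjSGD.law ρ n T = 𝔼 i, ∫ S, g (S, i) ∂Measure.pi fun _ : Fin n => ρ := by
  have : Nonempty (Fin n) := ⟨⟨0, hn⟩⟩
  have h := integrable_law ρ hn hm hg
  rw [ProjSGD.law] at h ⊢
  rw [integral_prod_symm _ h, integral_fintype Integrable.of_finite,
    Fintype.expect_eq_sum_div_card, Finset.sum_div]
  refine Finset.sum_congr rfl fun i _ => ?_
  have e : (Measure.pi fun _ : Fin T =>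
      ProbabilityTheory.uniformOn (Set.univ : Set (Fin n))).real {i}
      = (Fintype.card (Fin T → Fin n) : ℝ)⁻¹ := by
    simp [Measure.real, Measure.pi_singleton, ProbabilityTheory.uniformOn_univ]
  rw [e, smul_eq_mul, div_eq_inv_mul]

end Law

/-! ### Exchange symmetry of the sample and an additional point -/

section Swap

variable {Z : Type*} [MeasurableSpace Z] {n : ℕ}

/-- Exchange of the `k`-th data point with an additional one. -/
def swapPoint (k : Fin n) : (Fin n → Z) × Z ≃ᵐ (Fin n → Z) × Z :=
  MeasurableEquiv.ofInvolutive (fun x => (Function.update x.1 k x.2, x.1 k))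
    (fun x => by simp)
    ((measurable_pi_iff.2 fun l => by
      by_cases h : l = k
      · subst h; simpa using measurable_snd
      · simp only [Function.update_of_ne h]
        exact (measurable_pi_apply l).comp measurable_fst).prodMk
      ((measurable_pi_apply k).comp measurable_fst))

theorem swapPoint_apply (k : Fin n) (x : (Fin n → Z) × Z) :
    swapPoint k x = (Function.update x.1 k x.2, x.1 k) := rfl

/-- Splitting off coordinate `k` writes the exchange as a composition of reassociations and swaps of
product factors. -/
theorem measurePreserving_swapPoint (ρ : Measure Z) [IsProbabilityMeasure ρ] (k : Fin n) :
    MeasurePreserving (swapPoint (Z := Z) k) ((Measure.pi fun _ : Fin n => ρ).prod ρ)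
      ((Measure.pi fun _ : Fin n => ρ).prod ρ) := by
  cases n with
  | zero => exact k.elim0
  | succ m =>
    have h1 := measurePreserving_piFinSuccAbove (fun _ : Fin (m + 1) => ρ) k
    have h2 := h1.prod (MeasurePreserving.id ρ)
    have h3 := measurePreserving_prodAssoc ρ (Measure.pi fun _ : Fin m => ρ) ρ
    have h4 := Measure.measurePreserving_swap (μ := ρ) (ν := (Measure.pi fun _ : Fin m => ρ).prod ρ)
    have h5 := (Measure.measurePreserving_swap (μ := Measure.pi fun _ : Fin m => ρ) (ν := ρ)).prod
      (MeasurePreserving.id ρ)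
    have h6 := h1.symm.prod (MeasurePreserving.id ρ)
    have h := h6.comp (h5.comp (h4.comp (h3.comp h2)))
    convert h using 1
    funext x
    simp only [Function.comp_apply, Prod.map, id, swapPoint_apply, MeasurableEquiv.prodAssoc,
      MeasurableEquiv.piFinSuccAbove_symm_apply, MeasurableEquiv.piFinSuccAbove_apply]
    refine Prod.ext ?_ rfl
    exact (Fin.insertNth_removeNth k x.2 x.1).symm

end Swap

/-! ### Integration over the sample and an additional point -/

section Integrability

variable {d n T : ℕ} {Z : Type*} [MeasurableSpace Z] {f : EuclideanSpace ℝ (Fin d) → Z → ℝ}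
  {Ω : Set (EuclideanSpace ℝ (Fin d))} {η : Fin T → ℝ} {L : ℝ}
  {ρ : Measure Z} [IsProbabilityMeasure ρ]

/-- Smoothness, with `γ = L` in `le_one_add_mul`, dominates the loss at a random point by the loss
at `y` and the squared distance to `y`. The pathwise radius bounds supply `R`. -/
theorem IsSmoothConvexLoss.integrable_comp (hf : IsSmoothConvexLoss L f) {X : Type*}
    [MeasurableSpace X] {μ : Measure X} {W : X → EuclideanSpace ℝ (Fin d)} {ζ : X → Z} {R : X → ℝ}
    {y : EuclideanSpace ℝ (Fin d)} (hW : Measurable W) (hζ : Measurable ζ)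
    (hy : Integrable (fun x => f y (ζ x)) μ) (hR : Integrable R μ)
    (hWR : ∀ x, ‖W x - y‖ ^ 2 ≤ R x) : Integrable (fun x => f (W x) (ζ x)) μ := by
  have hL := hf.pos
  refine ((hy.const_mul (1 + L / L)).add (hR.const_mul ((L + L) / 2))).mono'
    (hf.measurable_uncurry.comp (hW.prodMk hζ)).aestronglyMeasurable
    (Filter.Eventually.of_forall fun x => ?_)
  rw [Real.norm_of_nonneg (hf.nonneg _ _)]
  refine ((hf.smooth (ζ x)).le_one_add_mul hL hL (hf.nonneg _) (W x) y).trans ?_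
  have := hWR x
  simp only [Pi.add_apply]
  gcongr

theorem measurable_risk_average (hf : IsSmoothConvexLoss L f) (hc : IsClosed Ω)
    (hconv : Convex ℝ Ω) (hne : Ω.Nonempty) (ρ : Measure Z) [SFinite ρ] (i : Fin T → Fin n) :
    Measurable fun S : Fin n → Z => ProjSGD.risk ρ f (ProjSGD.average f Ω η S i) :=
  (hf.measurable_risk ρ).comp (measurable_average hf hc hconv hne i)

theorem integrable_eval_fst {y : EuclideanSpace ℝ (Fin d)} (hy : Integrable (f y) ρ) (k : Fin n) :
    Integrable (fun x : (Fin n → Z) × Z => f y (x.1 k)) ((Measure.pi fun _ : Fin n => ρ).prod ρ) :=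
  ((measurePreserving_eval (fun _ : Fin n => ρ) k).comp
    measurePreserving_fst).integrable_comp_of_integrable hy

theorem integral_eval_fst {y : EuclideanSpace ℝ (Fin d)} (hy : Integrable (f y) ρ) (k : Fin n) :
    ∫ x : (Fin n → Z) × Z, f y (x.1 k) ∂(Measure.pi fun _ : Fin n => ρ).prod ρ
      = ProjSGD.risk ρ f y := by
  have h := (measurePreserving_eval (fun _ : Fin n => ρ) k).comp
    (measurePreserving_fst (μ := Measure.pi fun _ : Fin n => ρ) (ν := ρ))
  have e := integral_map (f := f y) h.measurable.aemeasurable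
    (by rw [h.map_eq]; exact hy.aestronglyMeasurable)
  rw [h.map_eq] at e
  exact e.symm

theorem integrable_radius {y : EuclideanSpace ℝ (Fin d)} (hy : Integrable (f y) ρ)
    (η : Fin T → ℝ) (i : Fin T → Fin n) :
    Integrable (fun x : (Fin n → Z) × Z => ‖y‖ ^ 2 + ∑ t, 2 * η t * f y (x.1 (i t)))
      ((Measure.pi fun _ : Fin n => ρ).prod ρ) :=
  (integrable_const _).add
    (integrable_finsetSum _ fun t _ => (integrable_eval_fst hy (i t)).const_mul _)

variable (hf : IsSmoothConvexLoss L f) (hc : IsClosed Ω)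
    (hconv : Convex ℝ Ω) (hη : ∀ t, 0 < η t) (hηL : ∀ t, η t ≤ 1 / (2 * L))
    {y : EuclideanSpace ℝ (Fin d)} (hy : y ∈ Ω) (hint : Integrable (f y) ρ)

include hf hc hconv hη hηL hy hint

theorem integrable_loss_iterate (i : Fin T → Fin n) (m : Fin (T + 1)) (k : Fin n) :
    Integrable (fun x : (Fin n → Z) × Z => f (ProjSGD.iterate f Ω η x.1 i m) (x.1 k))
      ((Measure.pi fun _ : Fin n => ρ).prod ρ) :=
  hf.integrable_comp ((measurable_iterate hf hc hconv ⟨y, hy⟩ i m).comp measurable_fst)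
    ((measurable_pi_apply k).comp measurable_fst) (integrable_eval_fst hint k)
    (integrable_radius hint η i) fun x => sq_norm_iterate_sub_le hf hc hconv hη hηL hy x.1 i m

theorem integrable_loss_average (hT : 0 < T) (i : Fin T → Fin n) (k : Fin n) :
    Integrable (fun x : (Fin n → Z) × Z => f (ProjSGD.average f Ω η x.1 i) (x.1 k))
      ((Measure.pi fun _ : Fin n => ρ).prod ρ) :=
  hf.integrable_comp ((measurable_average hf hc hconv ⟨y, hy⟩ i).comp measurable_fst)
    ((measurable_pi_apply k).comp measurable_fst) (integrable_eval_fst hint k)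
    (integrable_radius hint η i) fun x => sq_norm_average_sub_le hf hc hconv hη hηL hT hy x.1 i

theorem integrable_loss_average_snd (hT : 0 < T) (i : Fin T → Fin n) :
    Integrable (fun x : (Fin n → Z) × Z => f (ProjSGD.average f Ω η x.1 i) x.2)
      ((Measure.pi fun _ : Fin n => ρ).prod ρ) :=
  hf.integrable_comp ((measurable_average hf hc hconv ⟨y, hy⟩ i).comp measurable_fst)
    measurable_snd (measurePreserving_snd.integrable_comp_of_integrable hint)
    (integrable_radius hint η i) fun x => sq_norm_average_sub_le hf hc hconv hη hηL hT hy x.1 i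

theorem integrable_sq_norm_average_sub_average_swap (hT : 0 < T) (i : Fin T → Fin n) (k : Fin n) :
    Integrable (fun x : (Fin n → Z) × Z =>
      ‖ProjSGD.average f Ω η x.1 i - ProjSGD.average f Ω η (swapPoint k x).1 i‖ ^ 2)
      ((Measure.pi fun _ : Fin n => ρ).prod ρ) := by
  have hm : Measurable fun x : (Fin n → Z) × Z => ProjSGD.average f Ω η x.1 i :=
    (measurable_average hf hc hconv ⟨y, hy⟩ i).comp measurable_fst
  have hr := integrable_radius hint η i
  refine ((hr.const_mul 2).add (((measurePreserving_swapPoint ρ k).integrable_comp_of_integrable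
    hr).const_mul 2)).mono' ((hm.sub (hm.comp
      (swapPoint k).measurable)).norm.pow_const 2).aestronglyMeasurable
    (Filter.Eventually.of_forall fun x => ?_)
  have h1 := sq_norm_average_sub_le hf hc hconv hη hηL hT hy x.1 i
  have h2 := sq_norm_average_sub_le hf hc hconv hη hηL hT hy (swapPoint k x).1 i
  rw [Real.norm_of_nonneg (by positivity)]
  simp only [Pi.add_apply, Function.comp_apply]
  set a := ProjSGD.average f Ω η x.1 i
  set b := ProjSGD.average f Ω η (swapPoint k x).1 i
  have h3 := pow_le_pow_left₀ (norm_nonneg _) (norm_sub_le (a - y) (b - y)) 2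
  rw [sub_sub_sub_cancel_right] at h3
  nlinarith [sq_nonneg (‖a - y‖ - ‖b - y‖)]

theorem integral_expect_loss_average_le (hn : 0 < n) (hT : 0 < T) (hanti : Antitone η) :
    ∫ x : (Fin n → Z) × Z, 𝔼 i, 𝔼 k, f (ProjSGD.average f Ω η x.1 i) (x.1 k)
      ∂(Measure.pi fun _ : Fin n => ρ).prod ρ
      ≤ ProjSGD.risk ρ f y
        + (∑ t, η t)⁻¹ * (‖y‖ ^ 2 + 2 * L * (∑ t, η t ^ 2) * ProjSGD.risk ρ f y) := by
  have : Nonempty (Fin n) := ⟨⟨0, hn⟩⟩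
  have hF : Integrable (fun x : (Fin n → Z) × Z => 𝔼 k, f y (x.1 k))
      ((Measure.pi fun _ : Fin n => ρ).prod ρ) := integrable_expect (integrable_eval_fst hint)
  have hF2 := ((integrable_const (‖y‖ ^ 2)).add
    (hF.const_mul (2 * L * ∑ t, η t ^ 2))).const_mul (∑ t, η t)⁻¹
  have h := integral_mono (integrable_expect fun i => integrable_expect fun k =>
      integrable_loss_average hf hc hconv hη hηL hy hint hT i k) (hF.add hF2)
    fun x => expect_empirical_average_le hn hT hf hc hconv hη hanti hηL hy x.1
  refine h.trans_eq ?_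
  rw [integral_add' hF hF2, integral_const_mul,
    integral_add' (integrable_const _) (hF.const_mul _), integral_const_mul,
    integral_expect (integrable_eval_fst hint)]
  simp [integral_eval_fst hint]

theorem sum_sq_mul_expect_integral_le (hn : 0 < n) (hanti : Antitone η) :
    ∑ t, η t ^ 2 * 𝔼 i, 𝔼 k, ∫ x : (Fin n → Z) × Z,
        f (ProjSGD.iterate f Ω η x.1 i t.castSucc) (x.1 k)
        ∂(Measure.pi fun _ : Fin n => ρ).prod ρ
      ≤ ‖y‖ ^ 2 / (2 * L) + 2 * (∑ t, η t ^ 2) * ProjSGD.risk ρ f y := by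
  have : Nonempty (Fin n) := ⟨⟨0, hn⟩⟩
  have hF : Integrable (fun x : (Fin n → Z) × Z => 𝔼 k, f y (x.1 k))
      ((Measure.pi fun _ : Fin n => ρ).prod ρ) := integrable_expect (integrable_eval_fst hint)
  have hi := integrable_loss_iterate hf hc hconv hη hηL hy hint (n := n)
  have hi2 := fun (t : Fin T) (i : Fin T → Fin n) => integrable_expect (hi i t.castSucc)
  have hi3 := fun t : Fin T => integrable_expect (hi2 t)
  have h := integral_mono (integrable_finsetSum Finset.univ fun t _ =>
      (hi3 t).const_mul (η t ^ 2))
    ((integrable_const (‖y‖ ^ 2 / (2 * L))).add (hF.const_mul (2 * ∑ t, η t ^ 2)))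
    fun x => sum_sq_mul_expect_le hn hf hc hconv hη hanti hηL hy x.1
  rw [integral_finsetSum _ fun t _ => (hi3 t).const_mul (η t ^ 2),
    integral_add' (integrable_const _) (hF.const_mul _), integral_const_mul (2 * ∑ t, η t ^ 2),
    integral_expect (integrable_eval_fst hint)] at h
  simp only [integral_const_mul, integral_expect (hi2 _), integral_expect (hi _ _),
    integral_eval_fst hint, Fintype.expect_const, integral_const, probReal_univ, one_smul] at h
  exact h

theorem expect_integral_sq_norm_average_sub_le (hn : 0 < n) (hT : 0 < T) (hanti : Antitone η) :
    𝔼 k, ∫ x : (Fin n → Z) × Z, 𝔼 i,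
      ‖ProjSGD.average f Ω η x.1 i - ProjSGD.average f Ω η (swapPoint k x).1 i‖ ^ 2
      ∂(Measure.pi fun _ : Fin n => ρ).prod ρ
      ≤ 24 * L * (1 + (T : ℝ) / n) / n
        * (‖y‖ ^ 2 / (2 * L) + 2 * (∑ t, η t ^ 2) * ProjSGD.risk ρ f y) := by
  have hL := hf.pos
  have hi := integrable_loss_iterate hf hc hconv hη hηL hy hint (n := n)
  have hi' := fun (k : Fin n) (i : Fin T → Fin n) (t : Fin T) =>
    (measurePreserving_swapPoint ρ k).integrable_comp_of_integrable (hi i t.castSucc k)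
  have hadd : ∀ (k : Fin n) (t : Fin T) (i : Fin T → Fin n), Integrable
      (fun x : (Fin n → Z) × Z => f (ProjSGD.iterate f Ω η x.1 i t.castSucc) (x.1 k)
        + f (ProjSGD.iterate f Ω η (swapPoint k x).1 i t.castSucc) ((swapPoint k x).1 k))
      ((Measure.pi fun _ : Fin n => ρ).prod ρ) :=
    fun k t i => (hi i t.castSucc k).add (hi' k i t)
  have hadd2 := fun k t => integrable_expect (hadd k t)
  have h1 : ∀ k : Fin n, ∫ x : (Fin n → Z) × Z, 𝔼 i,
      ‖ProjSGD.average f Ω η x.1 i - ProjSGD.average f Ω η (swapPoint k x).1 i‖ ^ 2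
      ∂(Measure.pi fun _ : Fin n => ρ).prod ρ
      ≤ 12 * L * (1 + (T : ℝ) / n) / n * ∑ t, η t ^ 2 * 𝔼 i, (2 * ∫ x : (Fin n → Z) × Z,
        f (ProjSGD.iterate f Ω η x.1 i t.castSucc) (x.1 k)
        ∂(Measure.pi fun _ : Fin n => ρ).prod ρ) := by
    intro k
    have h := integral_mono
      (integrable_expect fun i =>
        integrable_sq_norm_average_sub_average_swap hf hc hconv hη hηL hy hint hT i k)
      ((integrable_finsetSum Finset.univ fun t _ => (hadd2 k t).const_mul (η t ^ 2)).const_mul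
        (12 * L * (1 + (T : ℝ) / n) / n))
      fun x => expect_sq_norm_average_sub_average_le hn hf hc hconv ⟨y, hy⟩ hη hηL hT
        (k := k) (S := x.1) (S' := (swapPoint k x).1)
        fun l hl => (Function.update_of_ne hl _ _).symm
    refine h.trans_eq ?_
    rw [integral_const_mul, integral_finsetSum _ fun t _ => (hadd2 k t).const_mul (η t ^ 2)]
    congr 1
    refine Finset.sum_congr rfl fun t _ => ?_
    rw [integral_const_mul, integral_expect (hadd k t)]
    congr 1
    refine Finset.expect_congr rfl fun i _ => ?_
    -- By exchange symmetry the losses of both trajectories at their own `k`-th point have the same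
    -- mean, hence the factor `2`.
    have e := (measurePreserving_swapPoint ρ k).integral_comp'
      (fun x : (Fin n → Z) × Z => f (ProjSGD.iterate f Ω η x.1 i t.castSucc) (x.1 k))
    refine (integral_add (hi i t.castSucc k) (hi' k i t)).trans ?_
    simp only [Function.comp_apply]
    rw [e, two_mul]
  refine (Finset.expect_le_expect fun k _ => h1 k).trans ?_
  have h2 := sum_sq_mul_expect_integral_le hf hc hconv hη hηL hy hint hn hanti
  simp only [← Finset.mul_expect, Finset.expect_sum_comm]
  have h3 := mul_le_mul_of_nonneg_left h2
    (by positivity : 0 ≤ 24 * L * (1 + (T : ℝ) / n) / n)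
  refine le_trans (le_of_eq ?_) h3
  rw [Finset.mul_sum, Finset.mul_sum]
  refine Finset.sum_congr rfl fun t _ => ?_
  rw [Finset.expect_comm]
  ring

/-- Population risk of the averaged iterate, before simplification of the constants. -/
theorem expect_integral_loss_average_snd_le (hn : 0 < n) (hT : 0 < T) (hanti : Antitone η)
    {γ : ℝ} (hγ : 0 < γ) :
    𝔼 i : Fin T → Fin n, ∫ x : (Fin n → Z) × Z, f (ProjSGD.average f Ω η x.1 i) x.2
      ∂(Measure.pi fun _ : Fin n => ρ).prod ρ
      ≤ (1 + L / γ) * (ProjSGD.risk ρ f y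
          + (∑ t, η t)⁻¹ * (‖y‖ ^ 2 + 2 * L * (∑ t, η t ^ 2) * ProjSGD.risk ρ f y))
        + (γ + L) / 2 * (24 * L * (1 + (T : ℝ) / n) / n
          * (‖y‖ ^ 2 / (2 * L) + 2 * (∑ t, η t ^ 2) * ProjSGD.risk ρ f y)) := by
  have hL := hf.pos
  have : Nonempty (Fin n) := ⟨⟨0, hn⟩⟩
  have ha := integrable_loss_average hf hc hconv hη hηL hy hint hT (n := n)
  have hs := integrable_sq_norm_average_sub_average_swap hf hc hconv hη hηL hy hint hT (n := n)
  have h1 : ∀ (i : Fin T → Fin n) (k : Fin n),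
      ∫ x : (Fin n → Z) × Z, f (ProjSGD.average f Ω η x.1 i) x.2
        ∂(Measure.pi fun _ : Fin n => ρ).prod ρ
      ≤ (1 + L / γ) * ∫ x : (Fin n → Z) × Z, f (ProjSGD.average f Ω η x.1 i) (x.1 k)
          ∂(Measure.pi fun _ : Fin n => ρ).prod ρ
        + (γ + L) / 2 * ∫ x : (Fin n → Z) × Z,
          ‖ProjSGD.average f Ω η x.1 i - ProjSGD.average f Ω η (swapPoint k x).1 i‖ ^ 2
          ∂(Measure.pi fun _ : Fin n => ρ).prod ρ := by
    intro i k
    have hsnd := (measurePreserving_swapPoint ρ k).integrable_comp_of_integrable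
      (integrable_loss_average_snd hf hc hconv hη hηL hy hint hT i)
    -- After the exchange, the test point is `z_k` and the average is trained on the sample with
    -- `z_k` replaced.
    rw [← (measurePreserving_swapPoint ρ k).integral_comp', ← integral_const_mul,
      ← integral_const_mul,
      ← integral_add ((ha i k).const_mul _) ((hs i k).const_mul _)]
    refine integral_mono hsnd (((ha i k).const_mul _).add ((hs i k).const_mul _)) fun x => ?_
    have h := (hf.smooth (x.1 k)).le_one_add_mul hL hγ (hf.nonneg _)
      (ProjSGD.average f Ω η (swapPoint k x).1 i) (ProjSGD.average f Ω η x.1 i)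
    rwa [norm_sub_rev] at h
  have h2 := Finset.expect_le_expect (s := Finset.univ) fun i _ =>
    Finset.expect_le_expect (s := Finset.univ) fun k _ => h1 i k
  simp only [Fintype.expect_const, Finset.expect_add_distrib, ← Finset.mul_expect] at h2
  refine h2.trans (add_le_add (mul_le_mul_of_nonneg_left ?_ (by positivity))
    (mul_le_mul_of_nonneg_left ?_ (by positivity)))
  · have h3 := integral_expect_loss_average_le hf hc hconv hη hηL hy hint hn hT hanti
    rw [integral_expect fun i => integrable_expect (ha i)] at h3
    simpa only [integral_expect (ha _)] using h3
  · have h3 := expect_integral_sq_norm_average_sub_le hf hc hconv hη hηL hy hint hn hT hanti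
    rw [Finset.expect_comm]
    simpa only [integral_expect fun i => hs i _] using h3

theorem integrable_risk_average (hT : 0 < T) (i : Fin T → Fin n) :
    Integrable (fun S => ProjSGD.risk ρ f (ProjSGD.average f Ω η S i))
      (Measure.pi fun _ : Fin n => ρ) :=
  (integrable_loss_average_snd hf hc hconv hη hηL hy hint hT i).integral_prod_left

theorem integral_risk_average_eq (hn : 0 < n) (hT : 0 < T) :
    ∫ ω, ProjSGD.risk ρ f (ProjSGD.average f Ω η ω.1 ω.2) ∂(ProjSGD.law ρ n T)
      = 𝔼 i : Fin T → Fin n, ∫ x : (Fin n → Z) × Z, f (ProjSGD.average f Ω η x.1 i) x.2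
        ∂(Measure.pi fun _ : Fin n => ρ).prod ρ := by
  rw [integral_law ρ hn (measurable_risk_average hf hc hconv ⟨_, hy⟩ ρ)
    (integrable_risk_average hf hc hconv hη hηL hy hint hT)]
  refine Finset.expect_congr rfl fun i _ => ?_
  rw [integral_prod _ (integrable_loss_average_snd hf hc hconv hη hηL hy hint hT i)]
  rfl

end Integrability

/-! ### Constants and conclusion -/

/-- The factor `1 + L` covers `1 + L/γ` and `(γ + L)/γ`, using `γ ≥ 1`. The summands `6B²` and `24L`
come from the stability term, which dominates the optimization constants. -/
theorem risk_bound_simplify {L γ F b B s q a : ℝ} (hL : 0 < L) (hγ : 1 ≤ γ) (hF : 0 ≤ F)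
    (hb : 0 ≤ b) (hbB : b ≤ B) (hs : 0 < s) (hq : 0 ≤ q) (ha : 0 ≤ a) :
    (1 + L / γ) * (F + s⁻¹ * (b ^ 2 + 2 * L * q * F))
        + (γ + L) / 2 * (24 * L * a * (b ^ 2 / (2 * L) + 2 * q * F)) - F
      ≤ (1 + L) * (6 * B ^ 2 + 24 * L + 1)
        * ((1 / γ + q / s) * F + 1 / s + γ * a * (1 + q * F)) := by
  have hγ0 : 0 < γ := by linarith
  have hb2 : b ^ 2 ≤ B ^ 2 := pow_le_pow_left₀ hb hbB 2
  have hLγ : L / γ ≤ L := div_le_self hL.le hγ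
  have hB := sq_nonneg B
  set K := 6 * B ^ 2 + 24 * L + 1
  have hK1 : 1 ≤ K := by simp only [K]; linarith
  have hKL : L ≤ (1 + L) * K := by nlinarith
  have h1 : L / γ * F ≤ (1 + L) * K * (1 / γ * F) := by
    have : L / γ * F = L * (1 / γ * F) := by ring
    rw [this]
    gcongr
  have h2 : (1 + L / γ) * (s⁻¹ * (b ^ 2 + 2 * L * q * F))
      ≤ (1 + L) * K * (q / s * F + 1 / s) := by
    have e : (1 + L) * K * (q / s * F + 1 / s) = (1 + L) * (s⁻¹ * (K * (1 + q * F))) := by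
      field_simp
      ring
    rw [e]
    have : b ^ 2 + 2 * L * q * F ≤ K * (1 + q * F) := by
      have hqF : 0 ≤ q * F := mul_nonneg hq hF
      have h3 : b ^ 2 ≤ K * 1 := by simp only [K]; linarith
      have h4 : 2 * L * (q * F) ≤ K * (q * F) :=
        mul_le_mul_of_nonneg_right (by simp only [K]; linarith) hqF
      linarith
    have h5 : 0 ≤ b ^ 2 + 2 * L * q * F := by positivity
    gcongr
  have h3 : (γ + L) / 2 * (24 * L * a * (b ^ 2 / (2 * L) + 2 * q * F))
      ≤ (1 + L) * K * (γ * a * (1 + q * F)) := by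
    have e : (γ + L) / 2 * (24 * L * a * (b ^ 2 / (2 * L) + 2 * q * F))
        = (γ + L) * (a * (6 * b ^ 2 + 24 * L * (q * F))) := by
      field_simp
      ring
    have e' : (1 + L) * K * (γ * a * (1 + q * F)) = (γ * (1 + L)) * (a * (K * (1 + q * F))) := by
      ring
    rw [e, e']
    have hqF : 0 ≤ q * F := mul_nonneg hq hF
    have h4 : 6 * b ^ 2 + 24 * L * (q * F) ≤ K * (1 + q * F) := by
      have h3 : 6 * b ^ 2 ≤ K * 1 := by simp only [K]; linarith
      have h4 : 24 * L * (q * F) ≤ K * (q * F) :=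
        mul_le_mul_of_nonneg_right (by simp only [K]; linarith) hqF
      linarith
    have h5 : γ + L ≤ γ * (1 + L) := by nlinarith
    gcongr
  linarith

end

theorem mainTheorem3 (L : ℝ) (hL : 0 < L) (B : ℝ) :
    ∃ C : ℝ, 0 < C ∧
      ∀ (d : ℕ) (Z : Type*) [MeasurableSpace Z] (ρ : Measure Z) [IsProbabilityMeasure ρ]
        (f : EuclideanSpace ℝ (Fin d) → Z → ℝ) (Ω : Set (EuclideanSpace ℝ (Fin d)))
        (wstar : EuclideanSpace ℝ (Fin d)) (n T : ℕ) (η : Fin T → ℝ) (γ : ℝ),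
        (∀ w, Measurable (f w)) →
        (∀ z w, 0 ≤ f w z) →
        (∀ z, ConvexOn ℝ Set.univ (fun w => f w z)) →
        (∀ z, ProjSGD.LSmooth L (fun w => f w z)) →
        IsClosed Ω → Convex ℝ Ω →
        wstar ∈ Ω → Integrable (f wstar) ρ → IsMinOn (ProjSGD.risk ρ f) Ω wstar → ‖wstar‖ ≤ B →
        0 < n → 0 < T →
        (∀ t, 0 < η t) → Antitone η → (∀ t, η t ≤ 1 / (2 * L)) →
        1 ≤ γ →
        Integrable (fun ω => ProjSGD.risk ρ f (ProjSGD.average f Ω η ω.1 ω.2))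
            (ProjSGD.law ρ n T) ∧
          (∫ ω, ProjSGD.risk ρ f (ProjSGD.average f Ω η ω.1 ω.2) ∂(ProjSGD.law ρ n T))
              - ProjSGD.risk ρ f wstar
            ≤ C * ((1 / γ + (∑ t, η t ^ 2) / (∑ t, η t)) * ProjSGD.risk ρ f wstar
                + 1 / (∑ t, η t)
                + γ * (1 + (T : ℝ) / n) / n
                    * (1 + (∑ t, η t ^ 2) * ProjSGD.risk ρ f wstar)) := by
  refine ⟨(1 + L) * (6 * B ^ 2 + 24 * L + 1), by positivity, ?_⟩
  intro d Z _ ρ _ f Ω wstar n T η γ hm h0 hcv hsm hc hconv hy hint _ hB hn hT hη hanti hηL hγ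
  have hf : IsSmoothConvexLoss L f := ⟨hL, hm, h0, hcv, hsm⟩
  have : Nonempty (Fin T) := ⟨⟨0, hT⟩⟩
  refine ⟨integrable_law ρ hn (measurable_risk_average hf hc hconv ⟨_, hy⟩ ρ)
    (integrable_risk_average hf hc hconv hη hηL hy hint hT), ?_⟩
  rw [integral_risk_average_eq hf hc hconv hη hηL hy hint hn hT]
  have h1 := expect_integral_loss_average_snd_le hf hc hconv hη hηL hy hint hn hT hanti
    (zero_lt_one.trans_le hγ)
  have h2 := risk_bound_simplify (a := (1 + (T : ℝ) / n) / n) hL hγ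
    (F := ProjSGD.risk ρ f wstar)
    (integral_nonneg fun z => h0 z wstar) (norm_nonneg wstar) hB
    (Finset.sum_pos (fun t _ => hη t) Finset.univ_nonempty)
    (Finset.sum_nonneg (s := Finset.univ) fun t _ => sq_nonneg (η t)) (by positivity)
  rw [← mul_div_assoc, ← mul_div_assoc] at h2
  linarith
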